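/- Let $\mathbb{F}$ be a finite field, let $n$ be a natural number, and let $V=\mathbb{F}^n$ be the space of row vectors, on which $\mathrm{GL}(n,\mathbb{F})$ acts by right multiplication. A subgroup $G\le \mathrm{GL}(n,\mathbb{F})$ is *irreducible* if $V\neq 0$ and the only $G$-invariant subspaces of $V$ are $0$ and $V$. It is *primitive* if it is irreducible and there is no set $\{V_1,\dots,V_k\}$ of $k>1$ nonzero subspaces of $V$ with $V=V_1\oplus\cdots\oplus V_k$ whose members are permuted by $G$. If $\mathrm{GL}(n,\mathbb{F})$ has a nonabelian nilpotent primitive subgroup, then $n=2m$ for some odd integer $m\geq 1$. -/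

import Mathlib

open scoped MatrixGroups

namespace LinearGroup

variable {F : Type*} [Field F] {n : ℕ}

/-- The natural right action of `GL (n, F)` on the space `V = F ^ n` of row vectors:
`g` acts as the `F`-linear map `v ↦ v * g`. -/
def rowAction (g : GL (Fin n) F) : (Fin n → F) →ₗ[F] (Fin n → F) :=
  Matrix.vecMulLinear (g : Matrix (Fin n) (Fin n) F)

/-- `G ≤ GL (n, F)` is irreducible: `V` is nonzero, and its only `G`-invariant subspaces are
`0` and `V`. -/
def IsIrreducible (G : Subgroup (GL (Fin n) F)) : Prop :=
  Nontrivial (Fin n → F) ∧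
    ∀ U : Submodule F (Fin n → F), (∀ g ∈ G, U.map (rowAction g) ≤ U) → U = ⊥ ∨ U = ⊤

/-- A system of imprimitivity for `G`: a set `S` of at least two nonzero subspaces of `V` such
that `V` is the direct sum of the members of `S`, and which is permuted by `G`
(each `g ∈ G` maps `S` into `S`; applied to `g` and its inverse, this says that `g` permutes
`S`). Since `V` has finite dimension, `S` is automatically finite. -/
structure IsSystemOfImprimitivity (G : Subgroup (GL (Fin n) F))
    (S : Set (Submodule F (Fin n → F))) : Prop where
  nontrivial : S.Nontrivial
  ne_bot : ∀ W ∈ S, W ≠ ⊥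
  indep : sSupIndep S
  sSup_eq_top : sSup S = ⊤
  map_mem : ∀ g ∈ G, ∀ W ∈ S, W.map (rowAction g) ∈ S

/-- `G ≤ GL (n, F)` is primitive: it is irreducible and has no system of imprimitivity. -/
def IsPrimitive (G : Subgroup (GL (Fin n) F)) : Prop :=
  IsIrreducible G ∧ ∀ S : Set (Submodule F (Fin n → F)), ¬ IsSystemOfImprimitivity G S

end LinearGroup

/-! Let `A` be a maximal abelian normal subgroup of `G`; nilpotency makes it its own centralizer. By
Clifford's theorem, primitivity forces every abelian normal subgroup to span a field, hence to be
cyclic (`IsPrimitiveRep.isCyclic`). Let `K = F[A]` and `q = |F|`. Then `G` acts `K`-semilinearly,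
and `G / A` embeds in the cyclic group `Gal(K/F)`. Choose `g₀` generating the image, of order `r`,
acting on `K` as the power `q ^ s` with `s * r = [K : F]`. Since `g₀ ^ r` is a scalar, surjectivity
of the norm and Galois descent give an eigenvector `u` of `g₀`. The line `K u` is `G`-invariant, so
it is `V`, and `n = s * r`.

As `G` is nonabelian, `r > 1`. For a prime `p ∣ r`, the element `h = g₀ ^ (r / p)` has order `p`
modulo `A` and acts on `A` as the power `1 + d`, where `d = q ^ (n / p) - 1`. Nilpotency gives `p ∣
d`. Unless `p = 2` and `d % 4 = 2`, multiplying `h` by an element of `A` yields an element of order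
`p` outside `A` which, with the subgroup of order `p` in `A`, generates a noncyclic abelian normal
subgroup (`eq_two_and_mod_four_of_conj_eq`). Hence `q ^ (n / 2)` is 3 modulo 4, not a square, and `n
/ 2` is odd. -/

namespace LinearGroup

/-! ### Divisibility of `(d + 1) ^ p - 1`. -/

section NumberTheory

theorem exists_add_one_pow_eq (d m : ℕ) : ∃ t, (d + 1) ^ m = 1 + m * d + d ^ 2 * t := by
  induction m with
  | zero => exact ⟨0, by simp⟩
  | succ m ih =>
    obtain ⟨t, ht⟩ := ih
    exact ⟨m + t * (d + 1), by rw [pow_succ, ht]; ring⟩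

theorem exists_geom_sum_eq (d m : ℕ) :
    ∃ t, ∑ i ∈ Finset.range m, (d + 1) ^ i = m + d * m.choose 2 + d ^ 2 * t := by
  induction m with
  | zero => exact ⟨0, by simp⟩
  | succ m ih =>
    obtain ⟨t, ht⟩ := ih
    obtain ⟨u, hu⟩ := exists_add_one_pow_eq d m
    refine ⟨t + u, ?_⟩
    rw [Finset.sum_range_succ, ht, hu, Nat.choose_succ_succ' m 1, Nat.choose_one_right]
    ring

/-- The cofactor of `d` in `(d + 1) ^ p - 1` is a geometric sum congruent to `p` modulo `d`. All
primes dividing `N` divide `d`, so if `p ∤ d` this sum is prime to `N` and can be cancelled. -/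
theorem prime_dvd_of_dvd_add_one_pow_sub_one {N d k p : ℕ} (hp : p.Prime) (hk : N ∣ d ^ k)
    (hN : N ∣ (d + 1) ^ p - 1) (hNd : ¬ N ∣ d) : p ∣ d := by
  by_contra hpd
  obtain ⟨t, ht⟩ := exists_geom_sum_eq d p
  have hS := geom_sum_mul_add d p
  rw [← hS, Nat.add_sub_cancel] at hN
  refine hNd (Nat.Coprime.dvd_of_dvd_mul_left ?_ hN)
  refine Nat.coprime_of_dvd fun l hl hlN hlS => ?_
  have hld : l ∣ d := hl.dvd_of_dvd_pow (hlN.trans hk)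
  rw [ht, add_assoc, ← Nat.dvd_add_iff_left
    (dvd_add (hld.mul_right _) ((hld.trans (dvd_pow_self d two_ne_zero)).mul_right _))] at hlS
  exact hpd ((Nat.prime_dvd_prime_iff_eq hl hp).1 hlS ▸ hld)

/-- The case assumption makes `d * p.choose 2` divisible by `p ^ 2`, so the geometric sum is `p * u`
with `u` congruent to 1 modulo `p`; then `u` is prime to `N` and cancels. -/
theorem dvd_mul_prime_of_dvd_add_one_pow_sub_one {N d k p : ℕ} (hp : p.Prime) (hk : N ∣ d ^ k)
    (hN : N ∣ (d + 1) ^ p - 1) (hpd : p ∣ d) (h : p ≠ 2 ∨ 4 ∣ d) : N ∣ p * d := by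
  obtain ⟨t, ht⟩ := exists_geom_sum_eq d p
  have hS := geom_sum_mul_add d p
  rw [← hS, Nat.add_sub_cancel] at hN
  obtain ⟨c, hc⟩ := hpd
  have hpc : p ∣ c * p.choose 2 := by
    rcases h with h | ⟨m, hm⟩
    · exact (hp.dvd_choose_self two_ne_zero (lt_of_le_of_ne hp.two_le (Ne.symm h))).mul_left _
    · by_cases h2 : p = 2
      · subst h2
        exact Dvd.dvd.mul_right ⟨m, by omega⟩ _
      · exact (hp.dvd_choose_self two_ne_zero (lt_of_le_of_ne hp.two_le (Ne.symm h2))).mul_left _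
  set u := 1 + (c * p.choose 2 + p * (c ^ 2 * t)) with hu
  have hSu : ∑ i ∈ Finset.range p, (d + 1) ^ i = p * u := by
    rw [ht, hu, hc]; ring
  have hpu : ¬ p ∣ u := by
    rw [hu, ← Nat.dvd_add_iff_left (dvd_add hpc (dvd_mul_right _ _))]
    exact hp.one_lt.ne' ∘ Nat.dvd_one.1
  rw [hSu, mul_right_comm] at hN
  refine Nat.Coprime.dvd_of_dvd_mul_right ?_ hN
  refine Nat.coprime_of_dvd fun l hl hlN hlu => ?_
  have hld : l ∣ d := hl.dvd_of_dvd_pow (hlN.trans hk)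
  have hlS : l ∣ ∑ i ∈ Finset.range p, (d + 1) ^ i := hSu ▸ hlu.mul_left p
  rw [ht, add_assoc, ← Nat.dvd_add_iff_left
    (dvd_add (hld.mul_right _) ((hld.trans (dvd_pow_self d two_ne_zero)).mul_right _))] at hlS
  exact hpu ((Nat.prime_dvd_prime_iff_eq hl hp).1 hlS ▸ hlu)

end NumberTheory

/-! ### Nilpotent groups whose abelian normal subgroups are cyclic. -/

section Group

variable {G : Type*} [Group G]

theorem closure_normal_of_conj_mem {S : Set G}
    (h : ∀ s ∈ S, ∀ g : G, g * s * g⁻¹ ∈ Subgroup.closure S) : (Subgroup.closure S).Normal := by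
  refine ⟨fun x hx g => ?_⟩
  have : Subgroup.closure S ≤ (Subgroup.closure S).comap (MulAut.conj g).toMonoidHom :=
    (Subgroup.closure_le _).2 fun s hs => by simpa using h s hs g
  simpa using this hx

theorem closure_mul_comm {S : Set G} (h : ∀ s ∈ S, ∀ t ∈ S, s * t = t * s) :
    ∀ x ∈ Subgroup.closure S, ∀ y ∈ Subgroup.closure S, x * y = y * x := by
  intro x hx y hy
  have := Subgroup.isMulCommutative_closure h
  exact setLike_mul_comm hx hy

/-- A cyclic group has at most `p` solutions of `x ^ p = 1`, and the powers of `z` already supply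
`p` of them. -/
theorem mem_zpowers_of_pow_prime_eq_one [Finite G] {C : Subgroup G} (hC : IsCyclic C) {p : ℕ}
    (hp : p.Prime) {z y : G} (hz : z ∈ C) (hy : y ∈ C) (hzp : z ^ p = 1) (hz1 : z ≠ 1)
    (hyp : y ^ p = 1) : y ∈ Subgroup.zpowers z := by
  classical
  have := Fintype.ofFinite C
  have hord : orderOf (⟨z, hz⟩ : C) = p := by
    have := Fact.mk hp
    rw [Subgroup.orderOf_mk]
    exact orderOf_eq_prime hzp hz1
  have hsub : (Finset.range p).image (fun i => (⟨z, hz⟩ : C) ^ i) ⊆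
      Finset.univ.filter fun x : C => x ^ p = 1 := by
    intro x hx
    obtain ⟨i, -, rfl⟩ := Finset.mem_image.1 hx
    rw [Finset.mem_filter, ← hord, pow_right_comm, pow_orderOf_eq_one, one_pow]
    exact ⟨Finset.mem_univ _, rfl⟩
  have hcard : ((Finset.range p).image (fun i => (⟨z, hz⟩ : C) ^ i)).card = p := by
    rw [Finset.card_image_of_injOn, Finset.card_range]
    intro i hi j hj hij
    rw [Finset.coe_range, Set.mem_Iio, ← hord] at hi hj
    exact pow_injOn_Iio_orderOf hi hj hij
  have heq := Finset.eq_of_subset_of_card_le hsub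
    (by rw [hcard]; exact IsCyclic.card_pow_eq_one_le hp.pos)
  have hmem : (⟨y, hy⟩ : C) ∈ Finset.univ.filter fun x : C => x ^ p = 1 := by
    rw [Finset.mem_filter]
    exact ⟨Finset.mem_univ _, Subtype.ext hyp⟩
  rw [← heq] at hmem
  obtain ⟨i, -, hi⟩ := Finset.mem_image.1 hmem
  exact ⟨i, by simpa using congrArg Subtype.val hi⟩

/-- Take `A` maximal among abelian normal subgroups and climb the upper central series: if `x`
centralizes `A`, its commutators lie one step lower and still centralize `A`, so they are in `A`.
Then `A` and `x` generate an abelian normal subgroup, and maximality applies. -/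
theorem exists_self_centralizing_abelian_normal [Finite G] [Group.IsNilpotent G] :
    ∃ A : Subgroup G, A.Normal ∧ (∀ a ∈ A, ∀ b ∈ A, a * b = b * a) ∧
      ∀ g, (∀ a ∈ A, g * a = a * g) → g ∈ A := by
  obtain ⟨A, hA⟩ := (Set.toFinite {A : Subgroup G | A.Normal ∧
    ∀ a ∈ A, ∀ b ∈ A, a * b = b * a}).exists_maximal ⟨⊥, inferInstance, by simp⟩
  obtain ⟨⟨hn, hc⟩, hmax⟩ := hA
  refine ⟨A, hn, hc, ?_⟩
  have key : ∀ k, ∀ x ∈ Subgroup.upperCentralSeries G k, (∀ a ∈ A, x * a = a * x) → x ∈ A := by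
    intro k
    induction k with
    | zero =>
      intro x hx _
      rw [Subgroup.upperCentralSeries_zero, Subgroup.mem_bot] at hx
      exact hx ▸ one_mem A
    | succ k ih =>
      intro x hx hxA
      have hcen : x ∈ Subgroup.centralizer (A : Set G) :=
        Subgroup.mem_centralizer_iff.2 fun a ha => (hxA a ha).symm
      have hx' : ∀ g : G, g * x * g⁻¹ * x⁻¹ ∈ A := by
        intro g
        have h1 := (Subgroup.mem_upperCentralSeries_succ_iff).1 hx g
        have h2 : x * g * x⁻¹ * g⁻¹ ∈ A := by
          refine ih _ h1 fun a ha => ?_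
          have h3 : x * g * x⁻¹ * g⁻¹ ∈ Subgroup.centralizer (A : Set G) := by
            have := Subgroup.Normal.conj_mem (inferInstance :
              (Subgroup.centralizer (A : Set G)).Normal) _ (inv_mem hcen) g
            simpa [mul_assoc] using mul_mem hcen this
          exact (Subgroup.mem_centralizer_iff.1 h3 a ha).symm
        simpa [mul_assoc] using inv_mem h2
      have hle : A ≤ Subgroup.closure (insert x (A : Set G)) := fun a ha =>
        Subgroup.subset_closure (Set.mem_insert_of_mem _ ha)
      have hxm : x ∈ Subgroup.closure (insert x (A : Set G)) :=
        Subgroup.subset_closure (Set.mem_insert _ _)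
      refine hmax ⟨closure_normal_of_conj_mem ?_, closure_mul_comm ?_⟩ hle hxm
      · rintro s (rfl | hs) g
        · simpa using mul_mem (hle (hx' g)) hxm
        · exact hle (hn.conj_mem s hs g)
      · rintro s (rfl | hs) t (rfl | ht)
        · rfl
        · exact hxA t ht
        · exact (hxA s hs).symm
        · exact hc s hs t ht
  obtain ⟨c, hc'⟩ := Group.IsNilpotent.nilpotent G
  exact fun g hg => key c g (hc' ▸ Subgroup.mem_top g) hg

theorem mul_pow_eq_of_mul_eq {b h z : G} (hb : h * b = b * z * h) (hzb : Commute z b)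
    (hzh : Commute z h) (m : ℕ) : (b * h) ^ m = b ^ m * z ^ m.choose 2 * h ^ m := by
  have hm : ∀ m : ℕ, h ^ m * b = b * z ^ m * h ^ m := by
    intro m
    induction m with
    | zero => simp
    | succ m ih =>
      calc h ^ (m + 1) * b = h * (h ^ m * b) := by rw [pow_succ', mul_assoc]
        _ = (h * b) * z ^ m * h ^ m := by rw [ih]; simp only [mul_assoc]
        _ = b * z * (h * z ^ m) * h ^ m := by rw [hb]; simp only [mul_assoc]
        _ = b * z ^ (m + 1) * h ^ (m + 1) := by
          rw [← (hzh.pow_left m).eq, pow_succ' z, pow_succ' h]; simp only [mul_assoc]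
  induction m with
  | zero => simp
  | succ m ih =>
    calc (b * h) ^ (m + 1) = b ^ m * z ^ m.choose 2 * (h ^ m * b) * h := by
          rw [pow_succ, ih]; simp only [mul_assoc]
      _ = b ^ m * (z ^ m.choose 2 * b) * z ^ m * h ^ m * h := by rw [hm]; simp only [mul_assoc]
      _ = b ^ (m + 1) * z ^ (m + 1).choose 2 * h ^ (m + 1) := by
          rw [(hzb.pow_left _).eq, Nat.choose_succ_succ' m 1, Nat.choose_one_right,
            Nat.add_comm m (m.choose _), pow_add z, pow_succ b, pow_succ h]
          simp only [mul_assoc]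

/-- The commutator of `h` with `a ^ d ^ k` is `a ^ d ^ (k + 1)`, so these powers descend the lower
central series. -/
theorem exists_orderOf_dvd_pow_of_conj_eq [Group.IsNilpotent G] {a h : G} {d : ℕ}
    (hd : h * a * h⁻¹ = a ^ (1 + d)) : ∃ k, orderOf a ∣ d ^ k := by
  have key : ∀ k, a ^ d ^ k ∈ (⊤ : Subgroup G).lowerCentralSeries k := by
    intro k
    induction k with
    | zero => simp
    | succ k ih =>
      have h1 : h * a ^ d ^ k * h⁻¹ = a ^ (d ^ k + d ^ (k + 1)) := by
        rw [← conj_pow, hd, ← pow_mul]; ring_nf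
      have h2 : a ^ d ^ (k + 1) = (a ^ d ^ k * h * (a ^ d ^ k)⁻¹ * h⁻¹)⁻¹ := by
        have : (a ^ d ^ k * h * (a ^ d ^ k)⁻¹ * h⁻¹)⁻¹ =
          (h * a ^ d ^ k * h⁻¹) * (a ^ d ^ k)⁻¹ := by simp [mul_assoc]
        rw [this, h1, Nat.add_comm (d ^ k), pow_add a, mul_inv_cancel_right]
      rw [h2, Subgroup.lowerCentralSeries_succ]
      refine inv_mem (Subgroup.subset_closure ?_)
      exact ⟨a ^ d ^ k, ih, h, Subgroup.mem_top _, rfl⟩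
  obtain ⟨k, hk⟩ := Subgroup.nilpotent_iff_lowerCentralSeries.1 (inferInstance : Group.IsNilpotent G)
  have := key k
  rw [hk, Subgroup.mem_bot] at this
  exact ⟨k, orderOf_dvd_of_pow_eq_one this⟩

/-- Let every abelian normal subgroup of `G` be cyclic, let `A` be an abelian normal subgroup
with `G / A` abelian, and let `z ∈ A` have order `p`. If `y ∈ G` has order dividing `p`,
centralizes `z`, and `c y` can only have order dividing `p` for `c ∈ A` if `c` has, then
`y ∈ A`. -/
theorem mem_of_pow_prime_eq_one [Finite G]
    (hcyc : ∀ B : Subgroup G, B.Normal → (∀ x ∈ B, ∀ y ∈ B, x * y = y * x) → IsCyclic B)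
    {A : Subgroup G} (hA : A.Normal) (hAcyc : IsCyclic A)
    (hcomm : ∀ x y : G, x * y * x⁻¹ * y⁻¹ ∈ A) {p : ℕ} (hp : p.Prime) {y z : G} (hz : z ∈ A)
    (hz1 : z ≠ 1) (hzp : z ^ p = 1) (hyp : y ^ p = 1) (hyz : Commute y z)
    (huniq : ∀ c ∈ A, (c * y) ^ p = 1 → c ^ p = 1) : y ∈ A := by
  have hzB : z ∈ Subgroup.closure {z, y} := Subgroup.subset_closure (by simp)
  have hyB : y ∈ Subgroup.closure {z, y} := Subgroup.subset_closure (by simp)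
  have hmem : ∀ c ∈ A, c ^ p = 1 → c ∈ Subgroup.closure {z, y} := fun c hc hcp =>
    (Subgroup.zpowers_le.2 hzB) (mem_zpowers_of_pow_prime_eq_one hAcyc hp hz hc hzp hz1 hcp)
  have hB : IsCyclic (Subgroup.closure {z, y}) := by
    refine hcyc _ (closure_normal_of_conj_mem ?_) (closure_mul_comm ?_)
    · rintro s (rfl | rfl) g
      · exact hmem _ (hA.conj_mem _ hz g) (by rw [conj_pow, hzp]; simp)
      -- Conjugating `y` multiplies it by a commutator in `A`, which `huniq` forces into the
      -- subgroup of order `p`, that is, into the powers of `z`.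
      · have h1 : g * s * g⁻¹ = g * s * g⁻¹ * s⁻¹ * s := by simp
        rw [h1]
        refine mul_mem (hmem _ (hcomm g s) (huniq _ (hcomm g s) ?_)) hyB
        rw [← h1, conj_pow, hyp]; simp
    · rintro s (rfl | rfl) t (rfl | rfl)
      · rfl
      · exact hyz.eq.symm
      · exact hyz.eq
      · rfl
  exact (Subgroup.zpowers_le.2 hz)
    (mem_zpowers_of_pow_prime_eq_one hB hp hzB hyB hzp hz1 hyp)

/-- Outside the exceptional case `z = a ^ d` has order `p` and commutes with `h`, so class-two power
formulas apply to `a ^ i * h`. They allow `h` to be adjusted to an element of order `p` outside the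
subgroup generated by `a`, against `mem_of_pow_prime_eq_one`. -/
theorem eq_two_and_mod_four_of_conj_eq [Finite G] [Group.IsNilpotent G]
    (hcyc : ∀ B : Subgroup G, B.Normal → (∀ x ∈ B, ∀ y ∈ B, x * y = y * x) → IsCyclic B)
    {a : G} (hA : (Subgroup.zpowers a).Normal)
    (hcomm : ∀ x y : G, x * y * x⁻¹ * y⁻¹ ∈ Subgroup.zpowers a)
    (hself : ∀ g, g * a = a * g → g ∈ Subgroup.zpowers a)
    {h : G} (hh : h ∉ Subgroup.zpowers a) {p : ℕ} (hp : p.Prime)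
    (hhp : h ^ p ∈ Subgroup.zpowers a) {d : ℕ} (hd : h * a * h⁻¹ = a ^ (1 + d)) :
    p = 2 ∧ d % 4 = 2 := by
  obtain ⟨k, hk⟩ := exists_orderOf_dvd_pow_of_conj_eq hd
  have hNd : ¬ orderOf a ∣ d := by
    intro hN
    rw [pow_add, pow_one, orderOf_dvd_iff_pow_eq_one.1 hN, mul_one, mul_inv_eq_iff_eq_mul] at hd
    exact hh (hself h hd)
  have hconj : ∀ m : ℕ, h ^ m * a * (h ^ m)⁻¹ = a ^ (d + 1) ^ m := by
    intro m
    induction m with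
    | zero => simp
    | succ m ih =>
      calc h ^ (m + 1) * a * (h ^ (m + 1))⁻¹ = h ^ m * (h * a * h⁻¹) * (h ^ m)⁻¹ := by
            rw [pow_succ]; simp [mul_assoc]
        _ = a ^ (d + 1) ^ (m + 1) := by
            rw [hd, ← conj_pow, ih, ← pow_mul, pow_succ, add_comm 1 d]
  have hcp : ∀ x ∈ Subgroup.zpowers a, Commute x a := by
    rintro x ⟨i, rfl⟩
    exact (Commute.refl a).zpow_left i
  have hNp : orderOf a ∣ (d + 1) ^ p - 1 := by
    have h1 := hconj p
    rw [(hcp _ hhp).eq, mul_inv_cancel_right] at h1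
    refine orderOf_dvd_of_pow_eq_one (mul_right_cancel (b := a) ?_)
    rw [← pow_succ, Nat.sub_add_cancel (Nat.one_le_pow' _ _), one_mul]
    exact h1.symm
  have hpd := prime_dvd_of_dvd_add_one_pow_sub_one hp hk hNp hNd
  suffices hcontra : ¬ (p ≠ 2 ∨ 4 ∣ d) by
    have : p = 2 ∧ ¬ 4 ∣ d := by tauto
    obtain ⟨rfl, h4⟩ := this
    exact ⟨rfl, by omega⟩
  intro hcase
  have hNpd := dvd_mul_prime_of_dvd_add_one_pow_sub_one hp hk hNp hpd hcase
  set z := a ^ d with hz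
  have hza : z ∈ Subgroup.zpowers a := Subgroup.npow_mem_zpowers a d
  have hz1 : z ≠ 1 := fun h1 => hNd (orderOf_dvd_of_pow_eq_one h1)
  have hzp : z ^ p = 1 := by
    rw [hz, ← pow_mul, mul_comm]; exact orderOf_dvd_iff_pow_eq_one.1 hNpd
  have hzord : orderOf z = p := by
    have := Fact.mk hp
    exact orderOf_eq_prime hzp hz1
  have hha : h * a = a * z * h := by
    rw [← mul_inv_eq_iff_eq_mul, hd, pow_add, pow_one]
  have hzpow : ∀ i : ℤ, p ∣ i.natAbs → z ^ i = 1 := fun i hi =>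
    orderOf_dvd_iff_zpow_eq_one.1 (by rw [hzord]; exact Int.natCast_dvd.2 hi)
  have hza' : Commute z a := hcp z hza
  have hhz : Commute h z := by
    obtain ⟨c, hc⟩ := hpd
    have : h * z * h⁻¹ = z := by
      rw [hz, ← conj_pow, hd, ← pow_mul, add_mul, one_mul, pow_add, pow_mul a d d, ← hz]
      rw [orderOf_dvd_iff_pow_eq_one.1 (hzord ▸ Dvd.intro _ hc.symm : orderOf z ∣ d), mul_one]
    exact mul_inv_eq_iff_eq_mul.1 this
  have hhai : ∀ i : ℤ, h * a ^ i = a ^ i * z ^ i * h := by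
    intro i
    rw [← mul_inv_eq_iff_eq_mul, ← conj_zpow, ← hza'.symm.mul_zpow, hha, mul_inv_cancel_right]
  have hpow : ∀ i j : ℤ, (a ^ i * (a ^ j * h)) ^ p =
      a ^ (i * p) * z ^ (i * p.choose 2) * (a ^ j * h) ^ p := by
    intro i j
    rw [mul_pow_eq_of_mul_eq (z := z ^ i), zpow_mul, zpow_mul, zpow_natCast, zpow_natCast]
    · calc a ^ j * h * a ^ i = a ^ (i + j) * z ^ i * h := by
            rw [mul_assoc, hhai, add_comm, zpow_add]; simp only [mul_assoc]
        _ = a ^ i * (a ^ j * z ^ i) * h := by rw [zpow_add]; simp only [mul_assoc]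
        _ = a ^ i * z ^ i * (a ^ j * h) := by
            rw [← (hza'.zpow_zpow i j).eq]; simp only [mul_assoc]
    · exact hza'.zpow_zpow i i
    · exact (hza'.zpow_zpow i j).mul_right (hhz.symm.zpow_left i)
  obtain ⟨t, ht⟩ := hhp
  -- `h` commutes with its power `h ^ p = a ^ t`, while conjugation by `h` multiplies `a ^ t` by `z
  -- ^ t`.
  have hpt : (p : ℤ) ∣ t := by
    rw [← hzord]
    refine orderOf_dvd_iff_zpow_eq_one.2 ?_
    have h1 := hhai t
    simp only at ht
    rw [ht, ← pow_succ', (hhz.symm.zpow_left t |>.pow_right p).eq.symm, mul_assoc, ← pow_succ] at h1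
    exact (mul_eq_right.1 h1.symm)
  obtain ⟨j, rfl⟩ := hpt
  have hstep : (a ^ (-j) * h) ^ p = z ^ (-j * p.choose 2) := by
    have h1 := hpow (-j) 0
    simp only [zpow_zero, one_mul] at h1
    simp only at ht
    rw [h1, ← ht, (hza'.zpow_zpow _ _).symm.eq, mul_assoc, ← zpow_add]
    ring_nf
    simp
  have hnot : ∀ j : ℤ, a ^ j * h ∉ Subgroup.zpowers a := fun j hj =>
    hh ((Subgroup.mul_mem_cancel_left _ (Subgroup.zpow_mem_zpowers a j)).1 hj)
  have hcz : ∀ j : ℤ, Commute (a ^ j * h) z := fun j =>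
    (hza'.symm.zpow_left j).mul_left hhz
  have hAcyc : IsCyclic (Subgroup.zpowers a) := inferInstance
  have hfin : ∀ j : ℤ, (a ^ j * h) ^ p = 1 →
      (∀ i : ℤ, a ^ (i * p) * z ^ (i * p.choose 2) = 1 → z ^ (i * p.choose 2) = 1) → False := by
    intro j hj hi
    refine hnot j (mem_of_pow_prime_eq_one hcyc hA hAcyc hcomm hp hza hz1 hzp hj (hcz j) ?_)
    rintro c ⟨i, rfl⟩ hc
    simp only at hc ⊢
    rw [hpow, hj, mul_one] at hc
    rwa [hi i hc, mul_one, zpow_mul, zpow_natCast] at hc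
  by_cases hp2 : p = 2
  · subst hp2
    have h4 : 4 ∣ d := hcase.resolve_left (by simp)
    -- `2 * d` is an odd multiple of the order of `a`, since that order does not divide `d`; and `8
    -- ∣ 2 * d`.
    have hN8 : 8 ∣ orderOf a := by
      obtain ⟨c, hc⟩ := hNpd
      obtain ⟨e, he⟩ := h4
      rcases Nat.even_or_odd' c with ⟨c', rfl | rfl⟩
      · exact absurd ⟨c', by linarith⟩ hNd
      · have h1 : 8 ∣ orderOf a * (2 * c' + 1) := ⟨e, by omega⟩
        exact (Nat.Coprime.dvd_mul_right
          (Nat.Coprime.pow_left 3 (Nat.coprime_two_left.2 ⟨c', rfl⟩))).1 h1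
    obtain ⟨M, hM⟩ := hN8
    simp only [Nat.choose_self, Nat.cast_one, mul_one] at hstep hpow hfin
    have hi : ∀ i : ℤ, a ^ (i * (2 : ℕ)) * z ^ i = 1 → z ^ i = 1 := by
      intro i hi
      rw [hz, ← zpow_natCast a d, ← zpow_mul, ← zpow_add, ← orderOf_dvd_iff_zpow_eq_one, hM] at hi
      obtain ⟨e, rfl⟩ := h4
      obtain ⟨x, hx⟩ := hi
      refine hzpow i ?_
      push_cast at hx
      have h2 : i * (1 + 2 * e) = 2 * (2 * M * x) := by linarith
      have h3 : Even (i * (1 + 2 * (e : ℤ))) := ⟨2 * M * x, by rw [h2]; ring⟩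
      rw [Int.even_mul] at h3
      rcases h3 with h3 | h3
      · exact even_iff_two_dvd.1 (Int.natAbs_even.2 h3)
      · exact absurd h3 (by simp [Int.even_add])
    by_cases hj : z ^ (-j) = 1
    · exact hfin (-j) (hstep.trans hj) hi
    -- Here the square of `a ^ (-j) * h` is `z`. As `a` has order `8 * M`, its power `a ^ (4 * M)`
    -- is the involution `z`, so the factor `a ^ (2 * M)` cancels it.
    · refine hfin (2 * M + -j) ?_ hi
      have hw : a ^ (2 * (M : ℤ) * (2 : ℕ)) = z := by
        have h1 : a ^ (4 * M) ∈ Subgroup.zpowers z := by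
          refine mem_zpowers_of_pow_prime_eq_one hAcyc hp hza
            (Subgroup.npow_mem_zpowers a _) hzp hz1 ?_
          rw [← pow_mul, ← orderOf_dvd_iff_pow_eq_one, hM]
          exact ⟨1, by ring⟩
        obtain ⟨x, hx⟩ := h1
        simp only at hx
        have h2 : a ^ (2 * (M : ℤ) * (2 : ℕ)) = a ^ (4 * M) := by
          rw [← zpow_natCast]; push_cast; ring_nf
        rw [h2, ← hx]
        rcases Int.even_or_odd' x with ⟨x', rfl | rfl⟩
        · exfalso
          rw [hzpow _ (by simp [Int.natAbs_mul])] at hx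
          have h3 := orderOf_dvd_of_pow_eq_one hx.symm
          have h4 := orderOf_pos a
          have h5 := Nat.le_of_dvd (by omega) h3
          omega
        · rw [zpow_add, hzpow _ (by simp [Int.natAbs_mul]), one_mul, zpow_one]
      have hz2 : z ^ (2 * (M : ℤ)) = 1 := hzpow _ (by simp [Int.natAbs_mul])
      rw [zpow_add, mul_assoc, hpow, hstep, hz2, hw, mul_one]
      rcases Int.even_or_odd' j with ⟨x', rfl | rfl⟩
      · exact absurd (hzpow _ (by simp [Int.natAbs_mul])) hj
      · rw [← zpow_one_add]
        exact hzpow _ (by rw [← Int.natCast_dvd]; exact ⟨-x', by push_cast; ring⟩)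
  · have hch : ∀ i : ℤ, z ^ (i * p.choose 2) = 1 := fun i => hzpow _ (by
      rw [Int.natAbs_mul, Int.natAbs_natCast]
      exact (hp.dvd_choose_self two_ne_zero (lt_of_le_of_ne hp.two_le (Ne.symm hp2))).mul_left _)
    exact hfin (-j) (hstep.trans (hch _)) fun i _ => hch i

end Group

/-! ### Clifford theory: abelian normal subgroups of primitive groups span fields. -/

section Clifford

universe v

variable {F : Type*} [Field F] {V : Type*} [AddCommGroup V] [Module F V]
  {G : Type*} [Group G]

/-- A representation is irreducible and permutes no nontrivial direct decomposition. -/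
structure IsPrimitiveRep (ρ : G →* Module.End F V) : Prop where
  nontrivial : Nontrivial V
  eq_bot_or_top : ∀ U : Submodule F V, (∀ g, U.map (ρ g) ≤ U) → U = ⊥ ∨ U = ⊤
  subsingleton : ∀ S : Set (Submodule F V), (∀ W ∈ S, W ≠ ⊥) → sSupIndep S → sSup S = ⊤ →
    (∀ g, ∀ W ∈ S, W.map (ρ g) ∈ S) → S.Subsingleton

theorem IsPrimitiveRep.sSup_eq_top {ρ : G →* Module.End F V} (hρ : IsPrimitiveRep ρ)
    {S : Set (Submodule F V)} (hne : ∃ W ∈ S, W ≠ ⊥)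
    (hS : ∀ g, ∀ W ∈ S, W.map (ρ g) ∈ S) : sSup S = ⊤ := by
  obtain ⟨W, hW, hW0⟩ := hne
  refine (hρ.eq_bot_or_top _ fun g => ?_).resolve_left
    fun h => hW0 (le_bot_iff.1 (h ▸ le_sSup hW))
  rw [sSup_eq_iSup, Submodule.map_iSup]
  refine iSup_le fun W => ?_
  rw [Submodule.map_iSup]
  refine iSup_le fun hW => ?_
  rw [← sSup_eq_iSup]
  exact le_sSup (hS g W hW)

theorem map_eq_of_forall_map_le {ρ : G →* Module.End F V} {ι : Type*} {t : ι → Submodule F V}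
    {a : G → ι → ι} (ha : ∀ g i, (t i).map (ρ g) ≤ t (a g i))
    (hinv : ∀ g i, a g⁻¹ (a g i) = i) (g : G) (i : ι) : (t i).map (ρ g) = t (a g i) := by
  refine le_antisymm (ha g i) fun v hv => ?_
  refine ⟨ρ g⁻¹ v, ?_, ?_⟩
  · have := ha g⁻¹ (a g i) (Submodule.mem_map_of_mem hv)
    rwa [hinv] at this
  · rw [← Module.End.mul_apply, ← map_mul, mul_inv_cancel, map_one, Module.End.one_apply]

section Torsion

variable {R : Type*} [CommRing R] [Algebra F R] [Module R V] [IsScalarTower F R V]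

theorem iSupIndep_torsionBySet_maximal [Finite R] :
    iSupIndep fun M : MaximalSpectrum R =>
      (Submodule.torsionBySet R V (M.asIdeal : Set R)).restrictScalars F := by
  classical
  have hfin : Finite (MaximalSpectrum R) :=
    Finite.of_injective (fun M : MaximalSpectrum R => (M.asIdeal : Set R)) fun M N h =>
      MaximalSpectrum.ext (SetLike.coe_injective h)
  have := Fintype.ofFinite (MaximalSpectrum R)
  have h1 : iSupIndep fun M : MaximalSpectrum R =>
      Submodule.torsionBySet R V (M.asIdeal : Set R) := by
    rw [iSupIndep_iff_supIndep_univ]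
    refine Submodule.supIndep_torsionBySet_ideal fun M _ N _ hMN => ?_
    exact M.isMaximal.coprime_of_ne N.isMaximal fun h => hMN (MaximalSpectrum.ext h)
  intro M
  have h2 := h1 M
  rw [disjoint_iff] at h2 ⊢
  simp only [← Submodule.restrictScalars_iSup, ← Submodule.restrictScalars_inf, h2,
    Submodule.restrictScalars_bot]

theorem exists_torsionBySet_maximal_ne_bot [Finite R] [Nontrivial V] [Finite V] :
    ∃ M : MaximalSpectrum R, Submodule.torsionBySet R V (M.asIdeal : Set R) ≠ ⊥ := by
  obtain ⟨W, hW⟩ := IsAtomic.exists_atom (Submodule R V)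
  have := isSimpleModule_iff_isAtom.2 hW
  have hmax := IsSimpleModule.annihilator_isMaximal (R := R) (M := W)
  refine ⟨⟨_, hmax⟩, fun h => hW.1 (le_bot_iff.1 (h ▸ fun w hw => ?_))⟩
  rw [Submodule.mem_torsionBySet_iff]
  rintro ⟨x, hx⟩
  exact congrArg Subtype.val (Module.mem_annihilator.1 hx ⟨w, hw⟩)

/-- Clifford's theorem for commutative algebras normalized by a primitive representation. -/
theorem IsPrimitiveRep.isField [Finite R] [Finite V] [FaithfulSMul R V]
    {ρ : G →* Module.End F V} (hρ : IsPrimitiveRep ρ) (θ : G → R ≃+* R)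
    (hθ : ∀ g, ∀ x : R, ∀ v, ρ g (x • v) = θ g x • ρ g v)
    (hinv : ∀ g x, θ g⁻¹ (θ g x) = x) : IsField R := by
  have := hρ.nontrivial
  let t : MaximalSpectrum R → Submodule F V := fun M =>
    (Submodule.torsionBySet R V (M.asIdeal : Set R)).restrictScalars F
  let a : G → MaximalSpectrum R → MaximalSpectrum R := fun g M =>
    have := M.isMaximal
    ⟨M.asIdeal.comap (θ g⁻¹), Ideal.comap_isMaximal_of_equiv (θ g⁻¹)⟩
  have hmap : ∀ g M, (t M).map (ρ g) = t (a g M) := by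
    refine map_eq_of_forall_map_le (fun g M => ?_) fun g M => ?_
    · rintro _ ⟨v, hv, rfl⟩
      refine (Submodule.mem_torsionBySet_iff _ _).2 ?_
      rintro ⟨x, hx⟩
      have h1 := hθ g (θ g⁻¹ x) v
      have h2 := hinv g⁻¹ x
      rw [inv_inv] at h2
      rw [h2, (Submodule.mem_torsionBySet_iff _ _).1 hv ⟨_, hx⟩, map_zero] at h1
      exact h1.symm
    · refine MaximalSpectrum.ext (Ideal.ext fun x => ?_)
      simp only [a, Ideal.mem_comap, inv_inv, hinv]
  -- The nonzero torsion parts are permuted by `G` and decompose `V`, so primitivity leaves just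
  -- one. Its maximal ideal kills `V` and vanishes by faithfulness.
  have hperm : ∀ g, ∀ W ∈ {W | ∃ M, t M = W ∧ W ≠ ⊥}, W.map (ρ g) ∈ {W | ∃ M, t M = W ∧ W ≠ ⊥} := by
    rintro g _ ⟨M, rfl, hM⟩
    refine ⟨a g M, (hmap g M).symm, fun h => hM (le_bot_iff.1 fun v hv => ?_)⟩
    have h1 : ρ g v ∈ (t M).map (ρ g) := Submodule.mem_map_of_mem hv
    rw [h, Submodule.mem_bot] at h1
    have h2 : ρ g⁻¹ (ρ g v) = v := by
      rw [← Module.End.mul_apply, ← map_mul, inv_mul_cancel, map_one, Module.End.one_apply]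
    rw [Submodule.mem_bot, ← h2, h1, map_zero]
  obtain ⟨M, hM⟩ := exists_torsionBySet_maximal_ne_bot (R := R) (V := V)
  have hM' : t M ≠ ⊥ := fun h => hM ((Submodule.restrictScalars_eq_bot_iff F R V).1 h)
  have htop := hρ.sSup_eq_top (S := {W | ∃ M, t M = W ∧ W ≠ ⊥}) ⟨t M, ⟨M, rfl, hM'⟩, hM'⟩ hperm
  have hsub := hρ.subsingleton _ (fun W hW => hW.choose_spec.2)
    ((iSupIndep_torsionBySet_maximal (F := F) (R := R) (V := V)).sSupIndep_range.mono
      fun W hW => ⟨hW.choose, hW.choose_spec.1⟩) htop hperm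
  have htM : t M = ⊤ := by
    rw [← htop]
    refine le_antisymm (le_sSup ⟨M, rfl, hM'⟩) (sSup_le fun W hW => ?_)
    rw [hsub hW ⟨M, rfl, hM'⟩]
  have hbot : M.asIdeal = ⊥ := by
    refine le_bot_iff.1 fun x hx => ?_
    refine eq_of_smul_eq_smul (α := V) fun v => ?_
    have hv : v ∈ t M := htM ▸ Submodule.mem_top
    rw [zero_smul]
    exact (Submodule.mem_torsionBySet_iff _ _).1 hv ⟨x, hx⟩
  by_contra hR
  have hmx := M.isMaximal
  have : Nontrivial R :=
    ⟨0, 1, fun h01 => hmx.ne_top ((Ideal.eq_top_iff_one _).2 (h01 ▸ zero_mem _))⟩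
  exact Ring.ne_bot_of_isMaximal_of_not_isField hmx hR hbot

end Torsion

/-- The endomorphism `x ↦ ρ g * x * ρ g⁻¹` of the algebra `Module.End F V`. -/
def conjAlgHom (ρ : G →* Module.End F V) (g : G) : Module.End F V →ₐ[F] Module.End F V :=
  AlgHom.ofLinearMap (LinearMap.mulLeft F (ρ g) ∘ₗ LinearMap.mulRight F (ρ g⁻¹))
    (by simp [← map_mul])
    (fun x y => by
      have h : ρ g⁻¹ * ρ g = 1 := by rw [← map_mul, inv_mul_cancel, map_one]
      simp only [LinearMap.comp_apply, LinearMap.mulLeft_apply, LinearMap.mulRight_apply]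
      calc ρ g * (x * y * ρ g⁻¹) = ρ g * (x * 1 * y * ρ g⁻¹) := by rw [mul_one]
        _ = _ := by rw [← h]; simp only [mul_assoc])

theorem conjAlgHom_apply (ρ : G →* Module.End F V) (g : G) (x : Module.End F V) :
    conjAlgHom ρ g x = ρ g * (x * ρ g⁻¹) := rfl

theorem conjAlgHom_mem_adjoin (ρ : G →* Module.End F V) {A : Subgroup G} (hA : A.Normal) (g : G)
    {x : Module.End F V} (hx : x ∈ Algebra.adjoin F (ρ '' A)) :
    conjAlgHom ρ g x ∈ Algebra.adjoin F (ρ '' A) := by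
  have h : (Algebra.adjoin F (ρ '' A)).map (conjAlgHom ρ g) ≤ Algebra.adjoin F (ρ '' A) := by
    rw [AlgHom.map_adjoin]
    refine Algebra.adjoin_mono ?_
    rintro _ ⟨_, ⟨a, ha, rfl⟩, rfl⟩
    refine ⟨g * a * g⁻¹, hA.conj_mem a ha g, ?_⟩
    rw [conjAlgHom_apply, map_mul, map_mul, mul_assoc]
  exact h ⟨x, hx, rfl⟩

theorem conjAlgHom_inv_apply (ρ : G →* Module.End F V) (g : G) (x : Module.End F V) :
    conjAlgHom ρ g⁻¹ (conjAlgHom ρ g x) = x := by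
  have h : ρ g⁻¹ * ρ g = 1 := by rw [← map_mul, inv_mul_cancel, map_one]
  simp only [conjAlgHom_apply, inv_inv]
  calc ρ g⁻¹ * (ρ g * (x * ρ g⁻¹) * ρ g) = (ρ g⁻¹ * ρ g) * x * (ρ g⁻¹ * ρ g) := by
        simp only [mul_assoc]
    _ = x := by rw [h, one_mul, mul_one]

/-- The algebra automorphism induced by `g` on the algebra spanned by a normal subgroup. -/
noncomputable def adjoinConj (ρ : G →* Module.End F V) {A : Subgroup G} (hA : A.Normal) (g : G) :
    Algebra.adjoin F (ρ '' A) ≃ₐ[F] Algebra.adjoin F (ρ '' A) :=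
  AlgEquiv.ofAlgHom
    (((conjAlgHom ρ g).comp (Subalgebra.val _)).codRestrict _
      fun x => conjAlgHom_mem_adjoin ρ hA g x.2)
    (((conjAlgHom ρ g⁻¹).comp (Subalgebra.val _)).codRestrict _
      fun x => conjAlgHom_mem_adjoin ρ hA g⁻¹ x.2)
    (AlgHom.ext fun x => Subtype.ext (by
      have := conjAlgHom_inv_apply ρ g⁻¹ x
      rwa [inv_inv] at this))
    (AlgHom.ext fun x => Subtype.ext (conjAlgHom_inv_apply ρ g x))

theorem coe_adjoinConj (ρ : G →* Module.End F V) {A : Subgroup G} (hA : A.Normal) (g : G)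
    (x : Algebra.adjoin F (ρ '' A)) :
    (adjoinConj ρ hA g x : Module.End F V) = conjAlgHom ρ g x := rfl

open scoped IsMulCommutative in
/-- An abelian normal subgroup of a primitive group generates a field. -/
theorem IsPrimitiveRep.exists_field {V : Type v} [AddCommGroup V] [Module F V] [Finite F]
    [Finite V] {ρ : G →* Module.End F V}
    (hρ : IsPrimitiveRep ρ) {A : Subgroup G} (hA : A.Normal)
    (hcomm : ∀ a ∈ A, ∀ b ∈ A, a * b = b * a) :
    ∃ (K : Type v) (_ : Field K) (_ : Algebra F K) (_ : Module K V) (_ : IsScalarTower F K V)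
      (ι : A →* K), Finite K ∧ (∀ (a : A) v, ρ a v = ι a • v) ∧
      ∀ g, ∃ σ : K ≃ₐ[F] K, ∀ (k : K) v, ρ g (k • v) = σ k • ρ g v := by
  have hc : IsMulCommutative (Algebra.adjoin F (ρ '' A)) := by
    refine Algebra.isMulCommutative_adjoin F ?_
    rintro _ ⟨a, ha, rfl⟩ _ ⟨b, hb, rfl⟩
    rw [← map_mul, hcomm a ha b hb, map_mul]
  have hfin : Finite (Module.End F V) :=
    Finite.of_injective (fun f : Module.End F V => (f : V → V)) DFunLike.coe_injective
  have hsemi : ∀ g (x : Algebra.adjoin F (ρ '' A)) (v : V),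
      ρ g (x • v) = adjoinConj ρ hA g x • ρ g v := by
    intro g x v
    have h : ρ g⁻¹ (ρ g v) = v := by
      rw [← Module.End.mul_apply, ← map_mul, inv_mul_cancel, map_one, Module.End.one_apply]
    change ρ g ((x : Module.End F V) v) = (adjoinConj ρ hA g x : Module.End F V) (ρ g v)
    rw [coe_adjoinConj, conjAlgHom_apply, Module.End.mul_apply, Module.End.mul_apply, h]
  have hfaith : FaithfulSMul (Algebra.adjoin F (ρ '' A)) V :=
    ⟨fun h => Subtype.ext (LinearMap.ext h)⟩
  have hfield : IsField (Algebra.adjoin F (ρ '' A)) :=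
    hρ.isField (fun g => (adjoinConj ρ hA g).toRingEquiv) hsemi
      fun g x => Subtype.ext (conjAlgHom_inv_apply ρ g x)
  refine ⟨Algebra.adjoin F (ρ '' A), hfield.toField, inferInstance, inferInstance,
    inferInstance, (ρ.comp A.subtype).codRestrict (Algebra.adjoin F (ρ '' A))
      (fun a => Algebra.subset_adjoin ⟨a, a.2, rfl⟩), inferInstance, fun a v => rfl,
    fun g => ⟨adjoinConj ρ hA g, hsemi g⟩⟩

end Clifford

/-! ### Norms and Galois descent over finite fields. -/

section FiniteField

variable {K : Type*} [Field K] {V : Type*} [AddCommGroup V] [Module K V]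

theorem exists_orderOf_eq_card_sub_one [Finite K] : ∃ γ : Kˣ, orderOf γ = Nat.card K - 1 ∧
    ∀ x, x ∈ Subgroup.zpowers γ := by
  obtain ⟨γ, hγ⟩ := IsCyclic.exists_generator (α := Kˣ)
  exact ⟨γ, by rw [orderOf_eq_card_of_forall_mem_zpowers hγ, Nat.card_units], hγ⟩

theorem exists_pow_ne_self [Finite K] {Q : ℕ} (hQ : 1 < Q) (hcard : Q < Nat.card K) :
    ∃ x : K, x ^ Q ≠ x := by
  by_contra! h
  obtain ⟨γ, hγ, -⟩ := exists_orderOf_eq_card_sub_one (K := K)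
  have h1 : γ ^ (Q - 1) = 1 := by
    refine mul_right_cancel (b := γ) (Units.ext ?_)
    rw [← pow_succ, Nat.sub_add_cancel hQ.le, one_mul, Units.val_pow_eq_pow_val, h]
  have h2 := Nat.le_of_dvd (by omega) (orderOf_dvd_of_pow_eq_one h1)
  omega

/-- Surjectivity of the norm map of an extension of finite fields. -/
theorem exists_pow_geom_sum_eq [Finite K] {Q r : ℕ} (hQ : 1 < Q) (hcard : Nat.card K = Q ^ r)
    {c : K} (hc0 : c ≠ 0) (hc : c ^ Q = c) : ∃ κ : K, κ ≠ 0 ∧ κ ^ (∑ i ∈ Finset.range r, Q ^ i) = c := by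
  obtain ⟨γ, hγ, hgen⟩ := exists_orderOf_eq_card_sub_one (K := K)
  obtain ⟨j, hj⟩ := hgen (Units.mk0 c hc0)
  simp only at hj
  have h1 : Units.mk0 c hc0 ^ ((Q - 1 : ℕ) : ℤ) = 1 := by
    rw [zpow_natCast]
    refine mul_right_cancel (b := Units.mk0 c hc0) (Units.ext ?_)
    rw [← pow_succ, Nat.sub_add_cancel hQ.le, one_mul, Units.val_pow_eq_pow_val, Units.val_mk0, hc]
  -- With `c = γ ^ j`, the order `Q ^ r - 1` of `γ` divides `j * (Q - 1)`; cancelling `Q - 1` shows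
  -- that the geometric sum divides `j`.
  have h3 := geom_sum_mul_add (Q - 1) r
  rw [Nat.sub_add_cancel hQ.le] at h3
  rw [← hj, ← zpow_mul, ← orderOf_dvd_iff_zpow_eq_one, hγ, hcard, ← h3, Nat.add_sub_cancel] at h1
  push_cast at h1
  have h2 : (((Q - 1 : ℕ)) : ℤ) ≠ 0 := by omega
  obtain ⟨x, hx⟩ := (mul_dvd_mul_iff_right h2).1 h1
  refine ⟨((γ ^ x : Kˣ) : K), Units.ne_zero _, ?_⟩
  rw [← Units.val_pow_eq_pow_val, ← zpow_natCast, ← zpow_mul, mul_comm, Nat.cast_sum]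
  push_cast
  rw [← hx, ← Units.val_zpow_eq_zpow_val, hj, Units.val_mk0]

theorem iterate_smul_eq {f : V →+ V} {Q : ℕ} (hf : ∀ (x : K) v, f (x • v) = x ^ Q • f v) (i : ℕ)
    (x : K) (v : V) : f^[i] (x • v) = x ^ Q ^ i • f^[i] v := by
  induction i with
  | zero => simp
  | succ i ih => rw [Function.iterate_succ_apply', Function.iterate_succ_apply', ih, hf, ← pow_mul,
      ← pow_succ]

/-- Galois descent: a semilinear automorphism of finite order `r` has a fixed vector. -/
theorem exists_fixed_vector [Finite K] [Nontrivial V] {f : V →+ V} {Q r : ℕ} (hQ : 1 < Q)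
    (hr : 0 < r)
    (hcard : Nat.card K = Q ^ r) (hf : ∀ (x : K) v, f (x • v) = x ^ Q • f v)
    (hfr : ∀ v, f^[r] v = v) : ∃ u, u ≠ 0 ∧ f u = u := by
  obtain ⟨v, hv⟩ := exists_ne (0 : V)
  have hfix : ∀ w, f (∑ i ∈ Finset.range r, f^[i] w) = ∑ i ∈ Finset.range r, f^[i] w := by
    intro w
    rw [map_sum]
    simp only [← Function.iterate_succ_apply' f]
    have h1 := Finset.sum_range_succ (fun i => f^[i] w) r
    rw [Finset.sum_range_succ', hfr] at h1
    exact add_right_cancel h1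
  by_contra! hno
  have hzero : ∀ x : K, ∑ i ∈ Finset.range r, x ^ Q ^ i • f^[i] v = 0 := by
    intro x
    by_contra hx
    simp only [← iterate_smul_eq hf] at hx
    exact hno _ hx (hfix _)
  obtain ⟨φ, hφ⟩ : ∃ φ : Module.Dual K V, φ v ≠ 0 := by
    by_contra! h
    exact hv ((Module.forall_dual_apply_eq_zero_iff K v).1 h)
  -- If all traces vanish, `P` is zero on `K` and has degree below `|K|`, yet its coefficient at `X`
  -- is `φ v`.
  let P : Polynomial K :=
    ∑ i ∈ Finset.range r, Polynomial.C (φ (f^[i] v)) * Polynomial.X ^ Q ^ i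
  have hP : P = 0 := by
    have := Fintype.ofFinite K
    refine Polynomial.eq_zero_of_natDegree_lt_card_of_eval_eq_zero' P Finset.univ (fun x _ => ?_) ?_
    · have h1 := congrArg φ (hzero x)
      rw [map_sum, map_zero] at h1
      rw [Polynomial.eval_finsetSum, ← h1]
      refine Finset.sum_congr rfl fun i _ => ?_
      rw [Polynomial.eval_mul, Polynomial.eval_C, Polynomial.eval_pow, Polynomial.eval_X,
        map_smul, smul_eq_mul, mul_comm]
    · rw [Finset.card_univ, ← Nat.card_eq_fintype_card, hcard]
      refine lt_of_le_of_lt (Polynomial.natDegree_sum_le_of_forall_le (n := Q ^ (r - 1)) _ _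
        fun i hi => ?_) (Nat.pow_lt_pow_right hQ (by omega))
      refine (Polynomial.natDegree_C_mul_X_pow_le _ _).trans ?_
      exact Nat.pow_le_pow_right (by omega) (by have := Finset.mem_range.1 hi; omega)
  have h1 := congrArg (fun p : Polynomial K => p.coeff 1) hP
  simp only [P, Polynomial.finsetSum_coeff, Polynomial.coeff_C_mul, Polynomial.coeff_X_pow,
    Polynomial.coeff_zero] at h1
  rw [Finset.sum_eq_single_of_mem 0 (Finset.mem_range.2 hr)] at h1
  · simp [hφ] at h1
  · intro i _ hi
    rw [if_neg, mul_zero]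
    exact (Nat.one_lt_pow hi hQ).ne

end FiniteField

/-! ### Semilinear actions through powers of Frobenius. -/

section Semilinear

variable {F : Type*} [Field F] {V : Type*} [AddCommGroup V] [Module F V] {G : Type*} [Group G]
  (K : Type*) [Field K] [Module K V]

/-- `ρ g` is semilinear over `K` with respect to the map `x ↦ x ^ Q`. -/
def IsPowSemilinear (ρ : G →* Module.End F V) (g : G) (Q : ℕ) : Prop :=
  ∀ (k : K) v, ρ g (k • v) = k ^ Q • ρ g v

variable {K} {ρ : G →* Module.End F V}

theorem IsPowSemilinear.mul {g h : G} {P Q : ℕ} (hg : IsPowSemilinear K ρ g P)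
    (hh : IsPowSemilinear K ρ h Q) : IsPowSemilinear K ρ (g * h) (P * Q) := fun k v => by
  rw [map_mul, Module.End.mul_apply, Module.End.mul_apply, hh, hg, ← pow_mul, mul_comm]

theorem IsPowSemilinear.pow {g : G} {Q : ℕ} (hg : IsPowSemilinear K ρ g Q) (d : ℕ) :
    IsPowSemilinear K ρ (g ^ d) (Q ^ d) := by
  induction d with
  | zero => intro k v; simp
  | succ d ih => rw [pow_succ, pow_succ]; exact ih.mul hg

theorem IsPowSemilinear.pow_eq [Nontrivial V] {g : G} {P Q : ℕ} (hP : IsPowSemilinear K ρ g P)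
    (hQ : IsPowSemilinear K ρ g Q) (k : K) : k ^ P = k ^ Q := by
  obtain ⟨v, hv⟩ := exists_ne (0 : V)
  have h1 : ρ g v ≠ 0 := fun h => hv <| by
    rw [← Module.End.one_apply (R := F) v, ← map_one ρ, ← inv_mul_cancel g, map_mul,
      Module.End.mul_apply, h, map_zero]
  exact smul_left_injective K h1 ((hP k v).symm.trans (hQ k v))

theorem isPowSemilinear_add_mul_iff [Finite K] {g : G} {q e t j : ℕ} (hK : Nat.card K = q ^ e) :
    IsPowSemilinear K ρ g (q ^ (t + e * j)) ↔ IsPowSemilinear K ρ g (q ^ t) := by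
  have h : ∀ k : K, k ^ q ^ (t + e * j) = k ^ q ^ t := fun k => by
    have := Fintype.ofFinite K
    rw [pow_add, pow_mul, pow_mul, ← hK, Nat.card_eq_fintype_card, FiniteField.pow_card_pow]
  simp only [IsPowSemilinear, h]

/-- Take `s` to be the least positive exponent that occurs; division with remainder shows that it
divides all others. The identity occurs with exponent `e`, whence `s ∣ e`. Exponents matter only
modulo `e`, so multiples of `e - 1` replace negative ones. -/
theorem exists_isPowSemilinear_generator [Finite K] {q e : ℕ} (he : 0 < e)
    (hK : Nat.card K = q ^ e) (hex : ∀ g, ∃ t, IsPowSemilinear K ρ g (q ^ t)) :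
    ∃ (g₀ : G) (s r : ℕ), s * r = e ∧ IsPowSemilinear K ρ g₀ (q ^ s) ∧
      ∀ g, ∃ d, IsPowSemilinear K ρ (g * g₀ ^ d) 1 := by
  classical
  have hone : IsPowSemilinear K ρ 1 (q ^ (0 + e * 1)) :=
    (isPowSemilinear_add_mul_iff hK).2 (fun k v => by simp)
  have hT : ∃ t, 0 < t ∧ ∃ g, IsPowSemilinear K ρ g (q ^ t) := ⟨_, by omega, _, hone⟩
  set s := Nat.find hT with hs
  obtain ⟨hs0, g₀, hg₀⟩ := Nat.find_spec hT
  rw [← hs] at hs0 hg₀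
  have hdvd : ∀ g t, IsPowSemilinear K ρ g (q ^ t) → s ∣ t := by
    intro g t hg
    have h1 : IsPowSemilinear K ρ (g * g₀ ^ ((e - 1) * (t / s))) (q ^ (t % s)) := by
      rw [← isPowSemilinear_add_mul_iff hK (j := s * (t / s))]
      have h2 := hg.mul (hg₀.pow ((e - 1) * (t / s)))
      rw [← pow_mul, ← pow_add] at h2
      convert h2 using 2
      obtain ⟨e', rfl⟩ : ∃ e', e = e' + 1 := ⟨e - 1, by omega⟩
      have h3 := Nat.mod_add_div t s
      nth_rw 3 [← h3]
      rw [Nat.add_sub_cancel]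
      ring
    refine Nat.dvd_of_mod_eq_zero ?_
    by_contra h0
    exact Nat.find_min hT (Nat.mod_lt t hs0) ⟨Nat.pos_of_ne_zero h0, _, h1⟩
  obtain ⟨r, hr⟩ := hdvd _ _ hone
  have hr' : e = s * r := by omega
  have hr0 : 0 < r := Nat.pos_of_ne_zero (by rintro rfl; omega)
  refine ⟨g₀, s, r, hr'.symm, hg₀, fun g => ?_⟩
  obtain ⟨t, ht⟩ := hex g
  obtain ⟨d, rfl⟩ := hdvd g t ht
  refine ⟨(r - 1) * d, ?_⟩
  suffices h0 : IsPowSemilinear K ρ (g * g₀ ^ ((r - 1) * d)) (q ^ 0) by rwa [pow_zero] at h0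
  rw [← isPowSemilinear_add_mul_iff hK (j := d)]
  have h2 := ht.mul (hg₀.pow ((r - 1) * d))
  rw [← pow_mul, ← pow_add] at h2
  convert h2 using 2
  obtain ⟨r', rfl⟩ : ∃ r', r = r' + 1 := ⟨r - 1, by omega⟩
  rw [hr', Nat.add_sub_cancel]
  ring

/-- The scalar `c` is fixed by the power `Q`, hence is a norm of some `κ`. Then `κ⁻¹ • ρ g₀` is
semilinear with `r`-th iterate the identity, and descent gives it a fixed vector. -/
theorem exists_eigenvector [Finite K] [Nontrivial V] {g₀ : G} {Q r : ℕ} (hQ : 1 < Q) (hr : 0 < r)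
    (hcard : Nat.card K = Q ^ r) (hg₀ : IsPowSemilinear K ρ g₀ Q) {c : K}
    (hc : ∀ v, ρ (g₀ ^ r) v = c • v) : ∃ u, u ≠ 0 ∧ ∃ κ : K, ρ g₀ u = κ • u := by
  obtain ⟨v, hv⟩ := exists_ne (0 : V)
  have hinj : ∀ g, ρ g v ≠ 0 := fun g h => hv <| by
    rw [← Module.End.one_apply (R := F) v, ← map_one ρ, ← inv_mul_cancel g, map_mul,
      Module.End.mul_apply, h, map_zero]
  have hc0 : c ≠ 0 := by
    rintro rfl
    exact hinj (g₀ ^ r) (by rw [hc, zero_smul])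
  have hcQ : c ^ Q = c := by
    refine smul_left_injective K (hinj g₀) ?_
    simp only
    rw [← hg₀, ← hc, ← hc, ← Module.End.mul_apply, ← Module.End.mul_apply, ← map_mul, ← map_mul,
      ← pow_succ, ← pow_succ']
  obtain ⟨κ, hκ0, hκ⟩ := exists_pow_geom_sum_eq hQ hcard hc0 hcQ
  let f : V →+ V := (DistribSMul.toAddMonoidHom V κ⁻¹).comp (ρ g₀).toAddMonoidHom
  have hf : ∀ v, f v = κ⁻¹ • ρ g₀ v := fun v => rfl
  have hiter : ∀ i v, f^[i] v = κ⁻¹ ^ (∑ j ∈ Finset.range i, Q ^ j) • ρ (g₀ ^ i) v := by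
    intro i v
    induction i with
    | zero => simp
    | succ i ih =>
      rw [Function.iterate_succ_apply', ih, hf, hg₀, smul_smul, ← pow_mul, ← pow_succ', geom_sum_succ,
        pow_succ' g₀, map_mul, Module.End.mul_apply, mul_comm Q]
  obtain ⟨u, hu, hfu⟩ := exists_fixed_vector (f := f) hQ hr hcard
    (fun x v => by rw [hf, hf, hg₀, smul_comm]) fun v => by
      rw [hiter, hc, inv_pow, hκ, inv_smul_smul₀ hc0]
  exact ⟨u, hu, κ, (inv_smul_eq_iff₀ hκ0).1 (hfu ▸ hf u).symm⟩

end Semilinear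

/-! ### Nilpotent primitive representations. -/

section Primitive

variable {F : Type*} [Field F] {V : Type*} [AddCommGroup V] [Module F V]
  {G : Type*} [Group G] {ρ : G →* Module.End F V}

theorem injective_of_forall_apply_eq_smul (hinj : Function.Injective ρ) {A : Subgroup G}
    {K : Type*} [Field K] [Module K V] {ι : A →* K} (hι : ∀ (a : A) v, ρ a v = ι a • v) :
    Function.Injective ι := fun a b hab =>
  Subtype.ext (hinj (LinearMap.ext fun v => by rw [hι, hι, hab]))

theorem IsPrimitiveRep.isCyclic [Finite F] [Finite V] [Finite G] (hρ : IsPrimitiveRep ρ)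
    (hinj : Function.Injective ρ)
    {A : Subgroup G} (hA : A.Normal) (hcomm : ∀ a ∈ A, ∀ b ∈ A, a * b = b * a) : IsCyclic A := by
  obtain ⟨K, _, _, _, _, ι, -, hι, -⟩ := hρ.exists_field hA hcomm
  exact isCyclic_of_injective_ringHom ι (injective_of_forall_apply_eq_smul hinj hι)

theorem exists_isPowSemilinear [Finite F] {K : Type*} [Field K] [Algebra F K] [Finite K]
    [Module K V] {g : G}
    {σ : K ≃ₐ[F] K} (hσ : ∀ (k : K) v, ρ g (k • v) = σ k • ρ g v) :
    ∃ t, IsPowSemilinear K ρ g (Nat.card F ^ t) := by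
  have := Fintype.ofFinite F
  have : FiniteDimensional F K := Module.Finite.of_finite
  obtain ⟨t, ht⟩ := (FiniteField.bijective_frobeniusAlgEquivOfAlgebraic_pow F K).2 σ
  refine ⟨t, fun k v => ?_⟩
  rw [hσ, ← ht, AlgEquiv.coe_pow, FiniteField.coe_frobeniusAlgEquivOfAlgebraic_iterate,
    Nat.card_eq_fintype_card]

/-- The Galois group of `K` over `F` is cyclic, so commutators act trivially on `K`. -/
theorem isPowSemilinear_commutator {K : Type*} [Field K] [Algebra F K] [Finite K] [Module K V]
    [Nontrivial V] (hσ : ∀ g, ∃ σ : K ≃ₐ[F] K, ∀ (k : K) v, ρ g (k • v) = σ k • ρ g v) (x y : G) :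
    IsPowSemilinear K ρ (x * y * x⁻¹ * y⁻¹) 1 := by
  have : FiniteDimensional F K := Module.Finite.of_finite
  choose σ hσ using hσ
  have huniq : ∀ g (τ : K ≃ₐ[F] K), (∀ (k : K) v, ρ g (k • v) = τ k • ρ g v) → σ g = τ := by
    intro g τ hτ
    refine AlgEquiv.ext fun k => ?_
    obtain ⟨v, hv⟩ := exists_ne (0 : V)
    have h1 : ρ g v ≠ 0 := fun h => hv <| by
      rw [← Module.End.one_apply (R := F) v, ← map_one ρ, ← inv_mul_cancel g, map_mul,
        Module.End.mul_apply, h, map_zero]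
    exact smul_left_injective K h1 ((hσ g k v).symm.trans (hτ k v))
  let φ : G →* (K ≃ₐ[F] K) := MonoidHom.mk' σ fun g h => huniq _ _ fun k v => by
    rw [map_mul, Module.End.mul_apply, Module.End.mul_apply, hσ, hσ, AlgEquiv.mul_apply]
  have hcomm : φ (x * y * x⁻¹ * y⁻¹) = 1 := by
    obtain ⟨γ, hγ⟩ := IsCyclic.exists_generator (α := K ≃ₐ[F] K)
    have hxy : Commute (φ x) (φ y) := by
      obtain ⟨i, hi⟩ := hγ (φ x)
      obtain ⟨j, hj⟩ := hγ (φ y)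
      rw [← hi, ← hj]
      exact (Commute.refl γ).zpow_zpow i j
    rw [map_mul, map_mul, map_mul, map_inv, map_inv, hxy.eq, mul_inv_cancel_right,
      mul_inv_cancel]
  intro k v
  rw [hσ, pow_one]
  have := DFunLike.congr_fun hcomm k
  exact congrArg (· • _) this

/-- If some `K`-line is invariant under a primitive group acting semilinearly over `K`, then it is
the whole space. -/
theorem IsPrimitiveRep.finrank_eq_of_eigenvector [Finite V] (hρ : IsPrimitiveRep ρ)
    {K : Type*} [Field K]
    [Algebra F K] [Module K V] [IsScalarTower F K V] {u : V} (hu : u ≠ 0)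
    (h : ∀ g, ∃ (Q : ℕ) (κ : K), IsPowSemilinear K ρ g Q ∧ ρ g u = κ • u) :
    Module.finrank F V = Module.finrank F K := by
  have htop := (hρ.eq_bot_or_top ((Submodule.span K {u}).restrictScalars F) ?_).resolve_left
    fun hbot => hu ?_
  · have h1 : ∀ v : V, ∃ k : K, k • u = v := fun v =>
      Submodule.mem_span_singleton.1 ((Submodule.restrictScalars_mem F _ v).1
        (htop ▸ Submodule.mem_top : v ∈ (Submodule.span K {u}).restrictScalars F))
    have h2 : Module.finrank K V = 1 := finrank_eq_one u hu h1
    rw [← Module.finrank_mul_finrank F K V, h2, mul_one]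
  · rintro g _ ⟨v, hv, rfl⟩
    obtain ⟨k, rfl⟩ := Submodule.mem_span_singleton.1 hv
    obtain ⟨Q, κ, hQ, hκ⟩ := h g
    rw [hQ, hκ, smul_smul]
    exact Submodule.smul_mem _ _ (Submodule.mem_span_singleton_self u)
  · have h1 : u ∈ (Submodule.span K {u}).restrictScalars F := Submodule.mem_span_singleton_self u
    rwa [hbot, Submodule.mem_bot] at h1

theorem odd_of_pow_sub_one_mod_four {q m : ℕ} (h : (q ^ m - 1) % 4 = 2) : Odd m := by
  by_contra hm
  obtain ⟨j, rfl⟩ := Nat.not_odd_iff_even.1 hm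
  rw [pow_add] at h
  generalize q ^ j = x at h
  have h1 : x * x % 4 = 3 := by omega
  rw [Nat.mul_mod] at h1
  have h2 : x % 4 < 4 := Nat.mod_lt _ (by norm_num)
  interval_cases x % 4 <;> omega

theorem IsPrimitiveRep.finrank_eq_two_mul_odd [Finite F] [Finite V] [Finite G] [Group.IsNilpotent G]
    (hρ : IsPrimitiveRep ρ) (hinj : Function.Injective ρ) (hnonab : ∃ a b : G, a * b ≠ b * a) :
    ∃ m, Odd m ∧ Module.finrank F V = 2 * m := by
  obtain ⟨A, hA, hAcomm, hAself⟩ := exists_self_centralizing_abelian_normal (G := G)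
  have := hρ.nontrivial
  have hcyc := hρ.isCyclic hinj hA hAcomm
  obtain ⟨K, _, _, _, _, ι, _, hι, hσ⟩ := hρ.exists_field hA hAcomm
  have hfd : FiniteDimensional F K := Module.Finite.of_finite
  -- A `K`-linear element commutes with `A`, which acts by scalars of `K`.
  have hmemA : ∀ g, IsPowSemilinear K ρ g 1 → g ∈ A := fun g hg => hAself g fun a ha =>
    hinj (LinearMap.ext fun v => by
      have h1 := hg (ι ⟨a, ha⟩) v
      rw [pow_one, ← hι, ← hι] at h1
      rw [map_mul, map_mul]
      exact h1)
  have hApow : ∀ a ∈ A, IsPowSemilinear K ρ a 1 := fun a ha k v => by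
    rw [hι ⟨a, ha⟩, hι ⟨a, ha⟩, smul_comm, pow_one]
  obtain ⟨⟨a, haA⟩, hgen⟩ := hcyc.exists_generator
  obtain rfl : A = Subgroup.zpowers a := by
    refine le_antisymm (fun x hx => ?_) (Subgroup.zpowers_le.2 haA)
    obtain ⟨i, hi⟩ := hgen ⟨x, hx⟩
    exact ⟨i, congrArg Subtype.val hi⟩
  set q := Nat.card F with hq
  have hq1 : 1 < q := Finite.one_lt_card
  have he : 0 < Module.finrank F K := Module.finrank_pos
  have hK : Nat.card K = q ^ Module.finrank F K := Module.natCard_eq_pow_finrank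
  obtain ⟨g₀, s, r, hsr, hg₀, hall⟩ := exists_isPowSemilinear_generator he hK
    fun g => exists_isPowSemilinear (hσ g).choose_spec
  have hs0 : 0 < s := Nat.pos_of_ne_zero (by rintro rfl; omega)
  have hr0 : 0 < r := Nat.pos_of_ne_zero (by rintro rfl; omega)
  have hKr : Nat.card K = (q ^ s) ^ r := by rw [hK, ← hsr, pow_mul]
  have hg₀r : g₀ ^ r ∈ Subgroup.zpowers a := by
    refine hmemA _ ?_
    have h1 := hg₀.pow r
    rw [← pow_mul, hsr, ← Nat.zero_add (Module.finrank F K), ← mul_one (Module.finrank F K),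
      isPowSemilinear_add_mul_iff hK, pow_zero] at h1
    exact h1
  have hr1 : r ≠ 1 := by
    rintro rfl
    rw [pow_one] at hg₀r
    have htop : ∀ g, g ∈ Subgroup.zpowers a := fun g => by
      obtain ⟨d, hd⟩ := hall g
      exact (Subgroup.mul_mem_cancel_right _ (pow_mem hg₀r d)).1 (hmemA _ hd)
    obtain ⟨x, y, hxy⟩ := hnonab
    exact hxy (hAcomm x (htop x) y (htop y))
  have hdim : Module.finrank F V = Module.finrank F K := by
    obtain ⟨u, hu, κ, hκ⟩ := exists_eigenvector (Nat.one_lt_pow hs0.ne' hq1) hr0 hKr hg₀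
      (c := ι ⟨_, hg₀r⟩) fun v => hι ⟨_, hg₀r⟩ v
    refine hρ.finrank_eq_of_eigenvector hu fun g => ?_
    obtain ⟨t, ht⟩ := exists_isPowSemilinear (hσ g).choose_spec
    obtain ⟨d, hd⟩ := hall g
    have hgd := hmemA _ hd
    have hpow : ∀ i, ∃ κ : K, ρ (g₀ ^ i) u = κ • u := by
      intro i
      induction i with
      | zero => exact ⟨1, by simp⟩
      | succ i ih =>
        obtain ⟨κ', h'⟩ := ih
        exact ⟨κ' ^ (q ^ s) * κ, by
          rw [pow_succ', map_mul, Module.End.mul_apply, h', hg₀, hκ, smul_smul]⟩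
    -- This exponent stands for `-d`, so `g` is recovered from `g * g₀ ^ d`, which lies in `A`.
    obtain ⟨κ₁, h₁⟩ := hpow ((orderOf g₀ - 1) * d)
    refine ⟨_, ι ⟨_, hgd⟩ * κ₁, ht, ?_⟩
    have h2 : (g * g₀ ^ d) * g₀ ^ ((orderOf g₀ - 1) * d) = g := by
      rw [mul_assoc, ← pow_add, add_comm d, ← Nat.succ_mul, Nat.succ_eq_add_one,
        Nat.sub_add_cancel (orderOf_pos g₀), pow_mul, pow_orderOf_eq_one, one_pow, mul_one]
    rw [← smul_smul, ← h₁, ← hι, ← Module.End.mul_apply, ← map_mul, h2]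
  obtain ⟨hp, r', hr'⟩ := And.intro (Nat.minFac_prime hr1) (Nat.minFac_dvd r)
  set p := r.minFac
  have hm0 : 0 < s * r' :=
    Nat.mul_pos hs0 (Nat.pos_of_ne_zero (by rintro rfl; omega))
  have hh := hg₀.pow r'
  rw [← pow_mul] at hh
  have hQ1 : 1 < q ^ (s * r') := Nat.one_lt_pow hm0.ne' hq1
  have hnot : g₀ ^ r' ∉ Subgroup.zpowers a := by
    intro hmem
    obtain ⟨x, hx⟩ := exists_pow_ne_self (K := K) hQ1 (by
      rw [hKr, hr', ← pow_mul]
      refine Nat.pow_lt_pow_right hq1 ?_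
      have := hp.two_le
      nlinarith)
    exact hx ((hh.pow_eq (hApow _ hmem) x).trans (pow_one x))
  -- Semilinearity turns the scalar of `a` into its `q ^ (s * r')` power, and faithfulness carries
  -- this back to `G`.
  have hd : g₀ ^ r' * a * (g₀ ^ r')⁻¹ = a ^ (1 + (q ^ (s * r') - 1)) := by
    rw [Nat.add_sub_cancel' hQ1.le, mul_inv_eq_iff_eq_mul]
    refine hinj (LinearMap.ext fun v => ?_)
    have h1 := hι (⟨a, haA⟩ ^ (q ^ (s * r'))) (ρ (g₀ ^ r') v)
    rw [map_pow ι, ← hh, ← hι] at h1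
    rw [map_mul, map_mul, Module.End.mul_apply, Module.End.mul_apply]
    exact h1.symm
  obtain ⟨hp2, h4⟩ := eq_two_and_mod_four_of_conj_eq (fun B hB hBc => hρ.isCyclic hinj hB hBc) hA
    (fun x y => hmemA _ (isPowSemilinear_commutator hσ x y))
    (fun g hg => hAself g fun b ⟨i, hi⟩ => hi ▸ (Commute.zpow_right hg i).eq) hnot hp
    (by rw [← pow_mul, mul_comm, ← hr']; exact hg₀r) hd
  exact ⟨s * r', odd_of_pow_sub_one_mod_four h4, by rw [hdim, ← hsr, hr', hp2]; ring⟩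

end Primitive

/-! ### Passage from matrix groups to representations. -/

section Matrix

variable {F : Type*} [Field F] {n : ℕ}

/-- The left representation on row vectors, `g` acting by `v ↦ v * g⁻¹`. -/
def rowRep (G : Subgroup (GL (Fin n) F)) : G →* Module.End F (Fin n → F) where
  toFun g := rowAction (g : GL (Fin n) F)⁻¹
  map_one' := LinearMap.ext fun v => by simp [rowAction]
  map_mul' g h := LinearMap.ext fun v => by simp [rowAction, Matrix.vecMul_vecMul]

theorem rowRep_injective (G : Subgroup (GL (Fin n) F)) : Function.Injective (rowRep G) := by
  intro g h hgh
  have h1 : ((g : GL (Fin n) F)⁻¹ : GL (Fin n) F).val = ((h : GL (Fin n) F)⁻¹ : GL (Fin n) F).val :=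
    Matrix.ext_of_single_vecMul fun i => LinearMap.congr_fun hgh _
  exact Subtype.ext (inv_injective (Units.ext h1))

theorem IsPrimitive.isPrimitiveRep {G : Subgroup (GL (Fin n) F)} (hG : IsPrimitive G) :
    IsPrimitiveRep (rowRep G) where
  nontrivial := hG.1.1
  eq_bot_or_top U hU := hG.1.2 U fun g hg => by
    -- The inverse cancels the one built into `rowRep`.
    have := hU ⟨g, hg⟩⁻¹
    simpa [rowRep] using this
  subsingleton S hne hind hsup hmap := by
    by_contra hS
    refine hG.2 S ⟨Set.not_subsingleton_iff.1 hS, hne, hind, hsup, fun g hg W hW => ?_⟩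
    have := hmap ⟨g, hg⟩⁻¹ W hW
    simpa [rowRep] using this

end Matrix

end LinearGroup

theorem proposition5p2 {F : Type*} [Field F] [Finite F] {n : ℕ}
    (G : Subgroup (GL (Fin n) F)) (hnonab : ∃ a ∈ G, ∃ b ∈ G, a * b ≠ b * a)
    (hnil : Group.IsNilpotent G) (hprim : LinearGroup.IsPrimitive G) :
    ∃ m : ℕ, Odd m ∧ n = 2 * m := by
  obtain ⟨a, ha, b, hb, hab⟩ := hnonab
  obtain ⟨m, hm, hn⟩ := hprim.isPrimitiveRep.finrank_eq_two_mul_odd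
    (LinearGroup.rowRep_injective G)
    ⟨⟨a, ha⟩, ⟨b, hb⟩, fun h => hab (congrArg Subtype.val h)⟩
  exact ⟨m, hm, by rw [← hn, Module.finrank_fin_fun]⟩
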